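/- Let $N\ge 1$ be an integer and let $a,b>0$ be real numbers. For a function $f$ on $[0,1]^N$ put \[ \langle f(x_1,\dots,x_N)\rangle_{a,b}=\frac1{N!}\int_{[0,1]^N} f(x_1,\dots,x_N)\prod_{1\le i<j\le N}(x_i-x_j)^2\prod_{i=1}^N x_i^{a-1}(1-x_i)^{b-1}\,dx_1\cdots dx_N , \] and for an integer $k>0$ let $p_k(x_1,\dots,x_N)=\sum_{i=1}^N x_i^k$. Then the integrals defining $\langle 1\rangle_{a,b}$ and $\langle p_k\rangle_{a,b}$ converge absolutely, $\langle 1\rangle_{a,b}>0$, and the quotient \[ I_k:=\frac{\langle p_k(x_1,\dots,x_N)\rangle_{a,b}}{\langle 1\rangle_{a,b}} \] satisfies \[ I_k=\frac1{k!}\sum_{i=0}^{k-1}(-1)^i\binom{k-1}{i}\prod_{j=-i}^{k-i-1}\frac{(N+j)(a+N+j-1)}{a+b+2N+j-2}. \] Here the summands with $i\ge N$, whose product contains the factor $N+j=0$ (at $j=-N$), are read as $0$ even if one of their denominators vanishes; for $i<N$ all denominators are positive. -/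

import Mathlib

open MeasureTheory

noncomputable section

/-- The (unnormalised) Jacobi weight
`∏_{i<j} (x_i - x_j)^2 ∏_i x_i^(a-1) (1 - x_i)^(b-1)`. -/
def jacobiWeight (N : ℕ) (a b : ℝ) (x : Fin N → ℝ) : ℝ :=
  (∏ i : Fin N, ∏ j ∈ Finset.Ioi i, (x i - x j) ^ 2) *
    ∏ i : Fin N, x i ^ (a - 1) * (1 - x i) ^ (b - 1)

/-- The bracket `⟨f⟩_{a,b}`: `1/N!` times the integral of `f` against the Jacobi weight over the
cube `[0,1]^N` (here `Set.Icc 0 1` for the coordinatewise order on `Fin N → ℝ`). -/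
def jacobiBracket (N : ℕ) (a b : ℝ) (f : (Fin N → ℝ) → ℝ) : ℝ :=
  1 / (N.factorial : ℝ) *
    ∫ x in Set.Icc (0 : Fin N → ℝ) 1, f x * jacobiWeight N a b x

/-- The power sum `p_k(x_1, …, x_N)`. -/
def powerSum (N k : ℕ) (x : Fin N → ℝ) : ℝ :=
  ∑ i : Fin N, x i ^ k

/-- `I_k = ⟨p_k⟩_{a,b} / ⟨1⟩_{a,b}`. -/
def jacobiMoment (N : ℕ) (a b : ℝ) (k : ℕ) : ℝ :=
  jacobiBracket N a b (powerSum N k) / jacobiBracket N a b (fun _ => 1)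

end

/-! ### Beta moments -/

/-! The weight is a Vandermonde determinant times a second one carrying the one-variable weights.
The Andréief identity thus makes `⟨1⟩` the Hankel determinant of the beta moments. Multiplying an
alternant by `p_k` raises one exponent `r` to `r + k`, so `⟨p_k⟩` is the sum over `r` of that
determinant with row `r` replaced by "row `r + k`".

Row `l` of moments is a positive scalar `w(l)` times the values at `l` of polynomials of degree `<
N`. Lagrange interpolation at `0, …, N - 1` therefore writes row `r + k` as a combination of the
existing rows, and only the coefficient of row `r` survives in the determinant (`det_beta_update`).
It is `w(r + k) / w(r)` times a Lagrange basis value, both explicit products; with `i = N - 1 - r`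
it is the `i`-th summand of the formula. -/

theorem integrableOn_pow_mul_jacobi {a b : ℝ} (ha : 0 < a) (hb : 0 < b) (n : ℕ) :
    IntegrableOn (fun x : ℝ => x ^ n * (x ^ (a - 1) * (1 - x) ^ (b - 1))) (Set.Icc 0 1) ∧
    ∫ x in Set.Icc (0 : ℝ) 1, x ^ n * (x ^ (a - 1) * (1 - x) ^ (b - 1)) =
      ProbabilityTheory.beta (a + n) b := by
  have han : 0 < a + n := by positivity
  -- The null endpoint `0` is dropped because adding real exponents needs `0 < x`.
  have hcongr : Set.EqOn (fun x : ℝ => x ^ n * (x ^ (a - 1) * (1 - x) ^ (b - 1)))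
      (fun x : ℝ => ((x : ℂ) ^ (((a + n : ℝ) : ℂ) - 1) * (1 - (x : ℂ)) ^ ((b : ℂ) - 1)).re)
      (Set.Ioc 0 1) := by
    intro x hx
    have h1 : (x : ℂ) ^ (((a + n : ℝ) : ℂ) - 1) = ((x ^ (a + n - 1) : ℝ) : ℂ) := by
      rw [Complex.ofReal_cpow hx.1.le]; push_cast; rfl
    have h2 : (1 - (x : ℂ)) ^ ((b : ℂ) - 1) = (((1 - x) ^ (b - 1) : ℝ) : ℂ) := by
      rw [Complex.ofReal_cpow (sub_nonneg.2 hx.2)]; push_cast; rfl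
    simp only [h1, h2, ← Complex.ofReal_mul, Complex.ofReal_re]
    rw [← mul_assoc, ← Real.rpow_natCast, ← Real.rpow_add hx.1]
    congr 2
    ring
  have hconv := Complex.betaIntegral_convergent (u := ((a + n : ℝ) : ℂ)) (v := b)
    (by simpa using han) (by simpa using hb)
  rw [intervalIntegrable_iff_integrableOn_Ioc_of_le zero_le_one] at hconv
  rw [integrableOn_Icc_iff_integrableOn_Ioc, integral_Icc_eq_integral_Ioc]
  refine ⟨IntegrableOn.congr_fun hconv.re hcongr.symm measurableSet_Ioc, ?_⟩
  rw [setIntegral_congr_fun measurableSet_Ioc hcongr,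
    ProbabilityTheory.beta_eq_betaIntegralReal _ _ han hb, Complex.betaIntegral,
    intervalIntegral.integral_of_le zero_le_one]
  exact integral_re hconv

theorem beta_add_one {a b : ℝ} (ha : 0 < a) (hb : 0 < b) :
    ProbabilityTheory.beta (a + 1) b = a / (a + b) * ProbabilityTheory.beta a b := by
  have hab : Real.Gamma (a + b) ≠ 0 := (Real.Gamma_pos_of_pos (add_pos ha hb)).ne'
  have hab' : a + b ≠ 0 := (add_pos ha hb).ne'
  rw [ProbabilityTheory.beta, ProbabilityTheory.beta, add_right_comm, Real.Gamma_add_one ha.ne',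
    Real.Gamma_add_one hab']
  field_simp

theorem beta_add_nat {a b : ℝ} (ha : 0 < a) (hb : 0 < b) (n : ℕ) :
    ProbabilityTheory.beta (a + n) b =
      (ascPochhammer ℝ n).eval a / (ascPochhammer ℝ n).eval (a + b) *
        ProbabilityTheory.beta a b := by
  induction n with
  | zero => simp
  | succ n ih =>
    have h1 : 0 < (ascPochhammer ℝ n).eval (a + b) := ascPochhammer_pos n _ (by positivity)
    have h2 : a + n + b ≠ 0 := by positivity
    have h3 : a + b + n ≠ 0 := by positivity
    rw [Nat.cast_succ, ← add_assoc, beta_add_one (by positivity) hb, ih,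
      ascPochhammer_succ_eval, ascPochhammer_succ_eval, add_right_comm a (n : ℝ) b]
    field_simp

/-! ### The Andréief identity -/

/-- Expand both determinants over `σ` and `τ` and apply Fubini to each product. For fixed `σ` the
sum over `τ` is the Gram determinant with rows permuted by `σ`, and the two signs of `σ` cancel;
hence `N!` equal terms. -/
theorem integrable_det_mul_det_and_integral {E : Type*} [MeasurableSpace E] (ν : Measure E)
    [SigmaFinite ν] {N : ℕ} (f g : Fin N → E → ℝ)
    (h : ∀ i j, Integrable (fun x => f i x * g j x) ν) :
    Integrable (fun x : Fin N → E => (Matrix.of fun j i => f j (x i)).det *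
      (Matrix.of fun j i => g j (x i)).det) (Measure.pi fun _ => ν) ∧
    ∫ x : Fin N → E, (Matrix.of fun j i => f j (x i)).det *
      (Matrix.of fun j i => g j (x i)).det ∂(Measure.pi fun _ => ν) =
      N.factorial * (Matrix.of fun i j => ∫ x, f i x * g j x ∂ν).det := by
  have hexp : ∀ x : Fin N → E, (Matrix.of fun j i => f j (x i)).det *
      (Matrix.of fun j i => g j (x i)).det = ∑ σ : Equiv.Perm (Fin N), ∑ τ : Equiv.Perm (Fin N),
        ((Equiv.Perm.sign σ : ℤ) : ℝ) * ((Equiv.Perm.sign τ : ℤ) : ℝ) *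
          ∏ i, f (σ i) (x i) * g (τ i) (x i) := by
    intro x
    rw [Matrix.det_apply', Matrix.det_apply', Finset.sum_mul_sum]
    refine Finset.sum_congr rfl fun σ _ => Finset.sum_congr rfl fun τ _ => ?_
    rw [Finset.prod_mul_distrib]
    simp only [Matrix.of_apply]
    ring
  have hint : ∀ σ τ : Equiv.Perm (Fin N), Integrable (fun x : Fin N → E =>
      ((Equiv.Perm.sign σ : ℤ) : ℝ) * ((Equiv.Perm.sign τ : ℤ) : ℝ) *
          ∏ i, f (σ i) (x i) * g (τ i) (x i)) (Measure.pi fun _ => ν) := fun σ τ =>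
    (Integrable.fintype_prod (f := fun i x => f (σ i) x * g (τ i) x)
      fun i => h (σ i) (τ i)).const_mul _
  simp only [hexp]
  refine ⟨integrable_finsetSum _ fun σ _ => integrable_finsetSum _ fun τ _ => hint σ τ, ?_⟩
  rw [integral_finsetSum _ fun σ _ => integrable_finsetSum _ fun τ _ => hint σ τ]
  have hσ : ∀ σ : Equiv.Perm (Fin N), ∫ x : Fin N → E, ∑ τ : Equiv.Perm (Fin N),
        ((Equiv.Perm.sign σ : ℤ) : ℝ) * ((Equiv.Perm.sign τ : ℤ) : ℝ) *
          ∏ i, f (σ i) (x i) * g (τ i) (x i) ∂(Measure.pi fun _ => ν) =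
      (Matrix.of fun i j => ∫ x, f i x * g j x ∂ν).det := by
    intro σ
    rw [integral_finsetSum _ fun τ _ => hint σ τ]
    set M := Matrix.of fun i j => ∫ x, f i x * g j x ∂ν with hM
    have hp := Matrix.det_permute σ M
    have hs : ((Equiv.Perm.sign σ : ℤ) : ℝ) * ((Equiv.Perm.sign σ : ℤ) : ℝ) = 1 := by
      rcases Int.units_eq_one_or (Equiv.Perm.sign σ) with h | h <;> simp [h]
    calc _ = ((Equiv.Perm.sign σ : ℤ) : ℝ) * (M.submatrix σ id).transpose.det := by
          rw [Matrix.det_apply', Finset.mul_sum]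
          refine Finset.sum_congr rfl fun τ _ => ?_
          rw [integral_const_mul, integral_fintype_prod_eq_prod
            (f := fun i x => f (σ i) x * g (τ i) x), mul_assoc]
          rfl
      _ = M.det := by rw [Matrix.det_transpose, hp, ← mul_assoc, hs, one_mul]
  simp only [hσ, Finset.sum_const, Finset.card_univ, Fintype.card_perm, Fintype.card_fin,
    nsmul_eq_mul]

/-! ### Jacobi brackets as determinants of moments -/

theorem volume_restrict_unitCube (N : ℕ) :
    (volume : Measure (Fin N → ℝ)).restrict (Set.Icc 0 1) =
      Measure.pi fun _ => volume.restrict (Set.Icc (0 : ℝ) 1) := by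
  rw [← Set.pi_univ_Icc, volume_pi, Measure.restrict_pi_pi]
  rfl

theorem jacobiWeight_eq_det_mul_det (N : ℕ) (a b : ℝ) (x : Fin N → ℝ) :
    jacobiWeight N a b x = (Matrix.of fun j i : Fin N => x i ^ (j : ℕ)).det *
      (Matrix.of fun j i : Fin N => x i ^ (j : ℕ) * (x i ^ (a - 1) * (1 - x i) ^ (b - 1))).det := by
  have h1 : (Matrix.of fun j i : Fin N => x i ^ (j : ℕ)).det = (Matrix.vandermonde x).det := by
    rw [← Matrix.det_transpose]; rfl
  have h2 : (Matrix.of fun j i : Fin N =>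
      x i ^ (j : ℕ) * (x i ^ (a - 1) * (1 - x i) ^ (b - 1))).det =
      (∏ i, x i ^ (a - 1) * (1 - x i) ^ (b - 1)) * (Matrix.vandermonde x).det := by
    rw [← h1, ← Matrix.det_mul_row]
    congr 1
    ext j i
    simp [mul_comm]
  rw [h1, h2, Matrix.det_vandermonde, jacobiWeight]
  have h3 : ∏ i : Fin N, ∏ j ∈ Finset.Ioi i, (x i - x j) ^ 2 =
      (∏ i : Fin N, ∏ j ∈ Finset.Ioi i, (x j - x i)) ^ 2 := by
    simp_rw [← Finset.prod_pow]
    exact Finset.prod_congr rfl fun i _ => Finset.prod_congr rfl fun j _ => by ring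
  rw [h3]
  ring

/-- Multiplying the alternant by a power sum shifts each exponent in turn. -/
theorem powerSum_mul_det (N k : ℕ) (x : Fin N → ℝ) :
    powerSum N k x * (Matrix.of fun j i : Fin N => x i ^ (j : ℕ)).det =
      ∑ r : Fin N, (Matrix.of fun j i : Fin N =>
        x i ^ (Function.update (fun j : Fin N => (j : ℕ)) r (r + k) j)).det := by
  have hterm : ∀ (σ : Equiv.Perm (Fin N)) (r : Fin N),
      ∏ i, x (σ i) ^ (Function.update (fun j : Fin N => (j : ℕ)) r (r + k) i) =
        x (σ r) ^ k * ∏ i, x (σ i) ^ (i : ℕ) := by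
    intro σ r
    rw [← Finset.mul_prod_erase _ _ (Finset.mem_univ r),
      ← Finset.mul_prod_erase _ (fun i : Fin N => x (σ i) ^ (i : ℕ)) (Finset.mem_univ r),
      Function.update_self, ← mul_assoc, ← pow_add, add_comm k]
    congr 1
    exact Finset.prod_congr rfl fun i hi => by
      rw [Function.update_of_ne (Finset.ne_of_mem_erase hi)]
  have hdet : ∀ e : Fin N → ℕ, (Matrix.of fun j i : Fin N => x i ^ e j).det =
      ∑ σ : Equiv.Perm (Fin N), ((Equiv.Perm.sign σ : ℤ) : ℝ) * ∏ i, x (σ i) ^ e i := by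
    intro e
    rw [← Matrix.det_transpose, Matrix.det_apply']
    rfl
  simp only [hdet, hterm]
  rw [Finset.sum_comm, Finset.mul_sum]
  refine Finset.sum_congr rfl fun σ _ => ?_
  have hp : powerSum N k x = ∑ r, x (σ r) ^ k := (Equiv.sum_comp σ fun i => x i ^ k).symm
  rw [hp, Finset.sum_mul]
  exact Finset.sum_congr rfl fun r _ => by ring

theorem integrable_det_mul_det_jacobi {a b : ℝ} (ha : 0 < a) (hb : 0 < b) {N : ℕ}
    (e : Fin N → ℕ) :
    IntegrableOn (fun x : Fin N → ℝ => (Matrix.of fun j i : Fin N => x i ^ e j).det *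
      (Matrix.of fun j i : Fin N =>
        x i ^ (j : ℕ) * (x i ^ (a - 1) * (1 - x i) ^ (b - 1))).det) (Set.Icc 0 1) ∧
    ∫ x in Set.Icc (0 : Fin N → ℝ) 1, (Matrix.of fun j i : Fin N => x i ^ e j).det *
      (Matrix.of fun j i : Fin N =>
        x i ^ (j : ℕ) * (x i ^ (a - 1) * (1 - x i) ^ (b - 1))).det =
      N.factorial * (Matrix.of fun i j : Fin N =>
        ProbabilityTheory.beta (a + ((e i + j : ℕ) : ℝ)) b).det := by
  have hmul : ∀ (i j : Fin N) (x : ℝ), x ^ e i * (x ^ (j : ℕ) * (x ^ (a - 1) * (1 - x) ^ (b - 1)))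
      = x ^ (e i + j) * (x ^ (a - 1) * (1 - x) ^ (b - 1)) := fun i j x => by
    rw [← mul_assoc, ← pow_add]
  have key := integrable_det_mul_det_and_integral (volume.restrict (Set.Icc (0 : ℝ) 1))
    (fun (j : Fin N) x => x ^ e j)
    (fun (j : Fin N) x => x ^ (j : ℕ) * (x ^ (a - 1) * (1 - x) ^ (b - 1)))
    (fun i j => by
      simp only [hmul]
      exact (integrableOn_pow_mul_jacobi ha hb _).1)
  rw [IntegrableOn, volume_restrict_unitCube]
  refine ⟨key.1, key.2.trans ?_⟩
  simp only [hmul, (integrableOn_pow_mul_jacobi ha hb _).2]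

theorem integrableOn_jacobiWeight {a b : ℝ} (ha : 0 < a) (hb : 0 < b) (N : ℕ) :
    IntegrableOn (jacobiWeight N a b) (Set.Icc (0 : Fin N → ℝ) 1) := by
  have h : jacobiWeight N a b = fun x => _ := funext (jacobiWeight_eq_det_mul_det N a b)
  rw [h]
  exact (integrable_det_mul_det_jacobi ha hb fun i => (i : ℕ)).1

theorem jacobiBracket_one {a b : ℝ} (ha : 0 < a) (hb : 0 < b) (N : ℕ) :
    jacobiBracket N a b (fun _ => 1) = (Matrix.of fun i j : Fin N =>
        ProbabilityTheory.beta (a + ((i + j : ℕ) : ℝ)) b).det := by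
  simp only [jacobiBracket, one_mul, jacobiWeight_eq_det_mul_det]
  rw [(integrable_det_mul_det_jacobi ha hb fun i => (i : ℕ)).2, ← mul_assoc, one_div,
    inv_mul_cancel₀ (by positivity), one_mul]

theorem powerSum_mul_jacobiWeight (N k : ℕ) (a b : ℝ) (x : Fin N → ℝ) :
    powerSum N k x * jacobiWeight N a b x = ∑ r : Fin N, (Matrix.of fun j i : Fin N =>
        x i ^ (Function.update (fun j : Fin N => (j : ℕ)) r (r + k) j)).det *
      (Matrix.of fun j i : Fin N =>
        x i ^ (j : ℕ) * (x i ^ (a - 1) * (1 - x i) ^ (b - 1))).det := by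
  rw [jacobiWeight_eq_det_mul_det, ← mul_assoc, powerSum_mul_det, Finset.sum_mul]

theorem integrableOn_powerSum_mul_jacobiWeight {a b : ℝ} (ha : 0 < a) (hb : 0 < b) (N k : ℕ) :
    IntegrableOn (fun x => powerSum N k x * jacobiWeight N a b x)
      (Set.Icc (0 : Fin N → ℝ) 1) := by
  simp only [powerSum_mul_jacobiWeight]
  exact integrable_finsetSum _ fun r _ => (integrable_det_mul_det_jacobi ha hb _).1

theorem jacobiBracket_powerSum {a b : ℝ} (ha : 0 < a) (hb : 0 < b) (N k : ℕ) :
    jacobiBracket N a b (powerSum N k) = ∑ r : Fin N, (Matrix.of fun i j : Fin N =>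
        ProbabilityTheory.beta (a +
          ((Function.update (fun j : Fin N => (j : ℕ)) r (r + k) i + j : ℕ) : ℝ)) b).det := by
  simp only [jacobiBracket, powerSum_mul_jacobiWeight]
  rw [integral_finsetSum _ fun r _ => (integrable_det_mul_det_jacobi ha hb _).1]
  simp only [(integrable_det_mul_det_jacobi ha hb _).2]
  rw [← Finset.mul_sum, ← mul_assoc, one_div, inv_mul_cancel₀ (by positivity), one_mul]

theorem jacobiBracket_one_pos {a b : ℝ} (ha : 0 < a) (hb : 0 < b) (N : ℕ) :
    0 < jacobiBracket N a b (fun _ => 1) := by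
  have hnonneg : ∀ x ∈ Set.Icc (0 : Fin N → ℝ) 1, 0 ≤ jacobiWeight N a b x := fun x hx =>
    mul_nonneg (Finset.prod_nonneg fun i _ => Finset.prod_nonneg fun j _ => sq_nonneg _)
      (Finset.prod_nonneg fun i _ => mul_nonneg (Real.rpow_nonneg (hx.1 i) _)
        (Real.rpow_nonneg (sub_nonneg.2 (hx.2 i)) _))
  -- The weight is nonzero at points of the open cube with distinct coordinates, a nonempty open set
  -- and so of positive measure.
  let U : Set (Fin N → ℝ) :=
    (⋂ i, {x | 0 < x i} ∩ {x | x i < 1}) ∩ ⋂ i, ⋂ j, ⋂ (_ : i ≠ j), {x | x i ≠ x j}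
  have hU : IsOpen U := by
    refine IsOpen.inter (isOpen_iInter_of_finite fun i => IsOpen.inter ?_ ?_)
      (isOpen_iInter_of_finite fun i => isOpen_iInter_of_finite fun j =>
        isOpen_iInter_of_finite fun _ => ?_)
    · exact isOpen_lt continuous_const (continuous_apply i)
    · exact isOpen_lt (continuous_apply i) continuous_const
    · exact isOpen_ne_fun (continuous_apply i) (continuous_apply j)
  have hne : U.Nonempty := by
    refine ⟨fun i => ((i : ℕ) + 1 : ℝ) / (N + 1), ?_, ?_⟩
    · refine Set.mem_iInter.2 fun i => ⟨?_, ?_⟩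
      · change (0 : ℝ) < ((i : ℕ) + 1) / (N + 1)
        positivity
      · change ((i : ℕ) + 1 : ℝ) / (N + 1) < 1
        refine (div_lt_one (by positivity)).2 ?_
        have : ((i : ℕ) : ℝ) < N := by exact_mod_cast i.2
        linarith
    · simp only [Set.mem_iInter, Set.mem_ofPred_eq]
      intro i j hij h
      rw [div_left_inj' (by positivity), add_left_inj, Nat.cast_inj] at h
      exact hij (Fin.ext h)
  have hsub : U ⊆ Function.support (jacobiWeight N a b) ∩ Set.Icc 0 1 := by
    rintro x ⟨h1, h2⟩
    simp only [Set.mem_iInter, Set.mem_ofPred_eq, Set.mem_inter_iff] at h1 h2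
    refine ⟨mul_ne_zero ?_ ?_, fun i => (h1 i).1.le, fun i => (h1 i).2.le⟩
    · refine Finset.prod_ne_zero_iff.2 fun i _ => Finset.prod_ne_zero_iff.2 fun j hj =>
        pow_ne_zero 2 (sub_ne_zero.2 (h2 i j (Finset.mem_Ioi.1 hj).ne))
    · exact Finset.prod_ne_zero_iff.2 fun i _ => mul_ne_zero
        (Real.rpow_pos_of_pos (h1 i).1 _).ne' (Real.rpow_pos_of_pos (sub_pos.2 (h1 i).2) _).ne'
  rw [jacobiBracket]
  simp only [one_mul]
  refine mul_pos (by positivity) ?_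
  rw [setIntegral_pos_iff_support_of_nonneg_ae
    (ae_restrict_of_forall_mem measurableSet_Icc hnonneg) (integrableOn_jacobiWeight ha hb N)]
  exact (hU.measure_pos volume hne).trans_le (measure_mono hsub)

/-! ### Replacing one row of the moment matrix -/

theorem ascPochhammer_eval_add (x : ℝ) (m n : ℕ) :
    (ascPochhammer ℝ (m + n)).eval x =
      (ascPochhammer ℝ m).eval x * (ascPochhammer ℝ n).eval (x + m) := by
  rw [← ascPochhammer_mul]
  simp

/-- The part of the moment `beta (a + (l + m)) b` which depends on the row `l` only. -/
noncomputable def betaRowFactor (N : ℕ) (a b : ℝ) (l : ℕ) : ℝ :=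
  ProbabilityTheory.beta (a + l) b / (ascPochhammer ℝ (N - 1)).eval (a + l + b)

/-- For `m < N`, the remaining factor of `beta (a + (l + m)) b`, a polynomial in `l`. -/
noncomputable def betaRowPoly (N : ℕ) (a b : ℝ) (m : ℕ) : Polynomial ℝ :=
  (ascPochhammer ℝ m).comp (Polynomial.X + Polynomial.C a) *
    (ascPochhammer ℝ (N - 1 - m)).comp (Polynomial.X + Polynomial.C (a + b + m))

theorem degree_betaRowPoly_lt {N m : ℕ} (hm : m < N) (a b : ℝ) :
    (betaRowPoly N a b m).degree < N := by
  refine (Polynomial.degree_le_natDegree).trans_lt ?_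
  rw [Nat.cast_lt]
  refine (Polynomial.natDegree_mul_le).trans_lt ?_
  rw [Polynomial.natDegree_comp, Polynomial.natDegree_comp, Polynomial.natDegree_X_add_C,
    Polynomial.natDegree_X_add_C, ascPochhammer_natDegree, ascPochhammer_natDegree]
  omega

theorem betaRowFactor_pos {a b : ℝ} (ha : 0 < a) (hb : 0 < b) (N l : ℕ) :
    0 < betaRowFactor N a b l :=
  div_pos (ProbabilityTheory.beta_pos (by positivity) hb)
    (ascPochhammer_pos _ _ (by positivity))

/-- Since `m ≤ N - 1`, the denominator `(a + l + b)_m` divides `(a + l + b)_{N-1}`, so the latter is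
a common denominator for the whole row. -/
theorem beta_eq_betaRowFactor_mul {a b : ℝ} (ha : 0 < a) (hb : 0 < b) {N m : ℕ} (hm : m < N)
    (l : ℕ) :
    ProbabilityTheory.beta (a + ((l + m : ℕ) : ℝ)) b =
      betaRowFactor N a b l * (betaRowPoly N a b m).eval (l : ℝ) := by
  have hal : 0 < a + l := by positivity
  have h1 : 0 < (ascPochhammer ℝ m).eval (a + l + b) := ascPochhammer_pos _ _ (by positivity)
  have h2 : 0 < (ascPochhammer ℝ (N - 1 - m)).eval (a + l + b + m) :=
    ascPochhammer_pos _ _ (by positivity)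
  have hsplit := ascPochhammer_eval_add (a + l + b) m (N - 1 - m)
  rw [show m + (N - 1 - m) = N - 1 by omega] at hsplit
  rw [Nat.cast_add, ← add_assoc, beta_add_nat hal hb, betaRowFactor, hsplit, betaRowPoly]
  simp only [Polynomial.eval_mul, Polynomial.eval_comp, Polynomial.eval_add, Polynomial.eval_X,
    Polynomial.eval_C]
  rw [show (l : ℝ) + a = a + l by ring, show (l : ℝ) + (a + b + m) = a + l + b + m by ring]
  field_simp

theorem betaRowFactor_add {a b : ℝ} (ha : 0 < a) (hb : 0 < b) {N : ℕ} (hN : 0 < N) (l k : ℕ) :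
    betaRowFactor N a b (l + k) = betaRowFactor N a b l *
      ∏ t ∈ Finset.range k, (a + l + t) / (a + b + l + t + N - 1) := by
  induction k with
  | zero => simp
  | succ k ih =>
    rw [Finset.prod_range_succ, ← mul_assoc, ← ih, ← add_assoc]
    have hx : 0 < a + ((l + k : ℕ) : ℝ) := by positivity
    set x := a + ((l + k : ℕ) : ℝ) with hxdef
    have h1 := ascPochhammer_eval_add (x + b) 1 (N - 1)
    have h2 := ascPochhammer_eval_add (x + b) (N - 1) 1
    -- Splitting `(x + b)_N` at either end gives `(x + b)_{N-1} (x + b + N - 1) = (x + b) (x + b +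
    -- 1)_{N-1}`.
    rw [add_comm 1, h2] at h1
    simp only [ascPochhammer_one, Polynomial.eval_X, Nat.cast_one] at h1
    have hp1 : 0 < (ascPochhammer ℝ (N - 1)).eval (x + b) := ascPochhammer_pos _ _ (by positivity)
    have hp2 : 0 < (ascPochhammer ℝ (N - 1)).eval (x + b + 1) :=
      ascPochhammer_pos _ _ (by positivity)
    have hx1 : a + ((l + k + 1 : ℕ) : ℝ) = x + 1 := by rw [hxdef]; push_cast; ring
    have hden : a + b + l + k + N - 1 = x + b + ((N - 1 : ℕ) : ℝ) := by
      rw [hxdef, Nat.cast_sub hN]; push_cast; ring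
    have hnum : a + l + k = x := by rw [hxdef]; push_cast; ring
    have hd : 0 < x + b + ((N - 1 : ℕ) : ℝ) := by positivity
    have hxb : 0 < x + b := by positivity
    rw [betaRowFactor, betaRowFactor, ← hxdef, hx1, beta_add_one hx hb, hden, hnum,
      show x + 1 + b = x + b + 1 by ring]
    rw [div_mul_eq_mul_div, div_div, div_mul_div_comm, div_eq_div_iff (by positivity) (by positivity)]
    linear_combination x * ProbabilityTheory.beta x b * h1

theorem eval_eq_sum_lagrange {N : ℕ} {p : Polynomial ℝ} (hp : p.degree < N) (y : ℝ) :
    p.eval y = ∑ s : Fin N, p.eval ((s : ℕ) : ℝ) *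
      (Lagrange.basis (Finset.range N) (fun n : ℕ => (n : ℝ)) s).eval y := by
  have h := Lagrange.eq_interpolate (s := Finset.range N) (v := fun n : ℕ => (n : ℝ))
    (f := p) (fun x _ y _ h => Nat.cast_injective h) (by simpa using hp)
  conv_lhs => rw [h]
  rw [Lagrange.interpolate_apply, Polynomial.eval_finsetSum, Finset.sum_range]
  simp

theorem det_beta_update {a b : ℝ} (ha : 0 < a) (hb : 0 < b) {N : ℕ} (r : Fin N) (k : ℕ) :
    (Matrix.of fun i j : Fin N => ProbabilityTheory.beta (a +
        ((Function.update (fun j : Fin N => (j : ℕ)) r (r + k) i + j : ℕ) : ℝ)) b).det =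
      (∏ t ∈ Finset.range k, (a + r + t) / (a + b + r + t + N - 1)) *
        (Lagrange.basis (Finset.range N) (fun n : ℕ => (n : ℝ)) r).eval ((r : ℝ) + k) *
        (Matrix.of fun i j : Fin N => ProbabilityTheory.beta (a + ((i + j : ℕ) : ℝ)) b).det := by
  set M := Matrix.of fun i j : Fin N => ProbabilityTheory.beta (a + ((i + j : ℕ) : ℝ)) b with hM
  -- Lagrange coefficients at `r + k`, rescaled from polynomial values to rows of `M`.
  let c : Fin N → ℝ := fun s => betaRowFactor N a b (r + k) / betaRowFactor N a b s *
    (Lagrange.basis (Finset.range N) (fun n : ℕ => (n : ℝ)) s).eval ((r : ℝ) + k)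
  have hrow : (Matrix.of fun i j : Fin N => ProbabilityTheory.beta (a +
        ((Function.update (fun j : Fin N => (j : ℕ)) r (r + k) i + j : ℕ) : ℝ)) b) =
      M.updateRow r (∑ s, c s • M s) := by
    ext i j
    rw [Matrix.updateRow_apply]
    split_ifs with hi
    · subst hi
      rw [Matrix.of_apply, Function.update_self, beta_eq_betaRowFactor_mul ha hb j.2,
        eval_eq_sum_lagrange (degree_betaRowPoly_lt j.2 a b), Finset.sum_apply, Finset.mul_sum]
      refine Finset.sum_congr rfl fun s _ => ?_
      have hs := (betaRowFactor_pos ha hb N s).ne'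
      rw [Pi.smul_apply, smul_eq_mul, hM, Matrix.of_apply, beta_eq_betaRowFactor_mul ha hb j.2]
      simp only [c, Nat.cast_add]
      field_simp
    · rw [Matrix.of_apply, Function.update_of_ne hi]
      rfl
  rw [hrow, Matrix.det_updateRow_sum, smul_eq_mul]
  congr 1
  simp only [c]
  rw [betaRowFactor_add ha hb r.pos, mul_div_cancel_left₀ _ (betaRowFactor_pos ha hb N r).ne']

/-! ### Evaluation of the Lagrange coefficients -/

/-- The contribution of the nodes below `r`; both sides equal `(r + k).choose r`. -/
theorem prod_range_inv_sub_mul_shift (r k : ℕ) :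
    ∏ s ∈ Finset.range r, ((r : ℝ) - s)⁻¹ * ((r : ℝ) + k - s) =
      1 / (k.factorial : ℝ) * ∏ t ∈ Finset.range k, ((r : ℝ) + 1 + t) := by
  induction r with
  | zero =>
    have : ∏ t ∈ Finset.range k, (((0 : ℕ) : ℝ) + 1 + t) = (k.factorial : ℝ) := by
      rw [← Finset.prod_range_add_one_eq_factorial]
      push_cast
      exact Finset.prod_congr rfl fun t _ => by ring
    rw [this]
    field_simp
    simp
  | succ r ih =>
    have h1 : ∏ t ∈ Finset.range k, (((r + 1 : ℕ) : ℝ) + 1 + t) =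
        ∏ t ∈ Finset.range k, ((r : ℝ) + 1 + ((t + 1 : ℕ) : ℝ)) :=
      Finset.prod_congr rfl fun t _ => by push_cast; ring
    have h2 := Finset.prod_range_succ (fun t : ℕ => (r : ℝ) + 1 + t) k
    rw [Finset.prod_range_succ'] at h2
    rw [h1, Finset.prod_range_succ']
    have h3 : ∏ s ∈ Finset.range r,
        (((r + 1 : ℕ) : ℝ) - ((s + 1 : ℕ) : ℝ))⁻¹ * (((r + 1 : ℕ) : ℝ) + k - ((s + 1 : ℕ) : ℝ)) =
        ∏ s ∈ Finset.range r, ((r : ℝ) - s)⁻¹ * ((r : ℝ) + k - s) :=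
      Finset.prod_congr rfl fun s _ => by
        push_cast
        congr 1
        · rw [add_sub_add_right_eq_sub]
        · ring
    rw [h3, ih]
    have hr : (r : ℝ) + 1 ≠ 0 := by positivity
    have hk : (k.factorial : ℝ) ≠ 0 := by positivity
    push_cast at h2 ⊢
    field_simp
    linear_combination -h2

/-- Each node `r + 1 + i` above `r` contributes `-(k - 1 - i) / (i + 1)`, the signed ratio of
consecutive binomials `(k - 1).choose i`. -/
theorem lagrange_basis_eval_shift (r i : ℕ) {k : ℕ} (hk : 0 < k) :
    (Lagrange.basis (Finset.range (r + 1 + i)) (fun n : ℕ => (n : ℝ)) r).eval ((r : ℝ) + k) =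
      (-1 : ℝ) ^ i * ((k - 1).choose i : ℝ) *
        (1 / (k.factorial : ℝ) * ∏ t ∈ Finset.range k, ((r : ℝ) + 1 + t)) := by
  have hev : ∀ n, (Lagrange.basis (Finset.range n) (fun n : ℕ => (n : ℝ)) r).eval ((r : ℝ) + k) =
      ∏ s ∈ (Finset.range n).erase r, ((r : ℝ) - s)⁻¹ * ((r : ℝ) + k - s) := by
    intro n
    simp [Lagrange.basis, Polynomial.eval_prod, Lagrange.basisDivisor]
  rw [hev]
  induction i with
  | zero =>
    rw [add_zero, Finset.range_add_one, Finset.erase_insert (by simp), prod_range_inv_sub_mul_shift]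
    simp
  | succ i ih =>
    rw [← add_assoc, Finset.range_add_one, Finset.erase_insert_of_ne (by omega),
      Finset.prod_insert (by simp), ih]
    have hc : ((k - 1).choose (i + 1) : ℝ) * (i + 1) = (k - 1).choose i * ((k : ℝ) - 1 - i) := by
      rcases le_or_gt i (k - 1) with h | h
      · have := Nat.choose_succ_right_eq (k - 1) i
        have h' : ((k - 1 - i : ℕ) : ℝ) = (k : ℝ) - 1 - i := by
          rw [Nat.cast_sub h, Nat.cast_sub hk]; simp
        rw [← h']
        exact_mod_cast this
      · rw [Nat.choose_eq_zero_of_lt h, Nat.choose_eq_zero_of_lt (by omega)]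
        simp
    have hi : (i : ℝ) + 1 ≠ 0 := by positivity
    have hs : ((r : ℝ) - ((r + 1 + i : ℕ) : ℝ))⁻¹ * ((r : ℝ) + k - ((r + 1 + i : ℕ) : ℝ)) =
        -(((k : ℝ) - 1 - i) / (i + 1)) := by
      push_cast
      rw [show (r : ℝ) - (r + 1 + i) = -(i + 1) by ring, inv_neg]
      field_simp
      ring
    have hc' : ((k - 1).choose (i + 1) : ℝ) =
        (k - 1).choose i * (((k : ℝ) - 1 - i) / (i + 1)) := by
      rw [← mul_div_assoc, eq_div_iff hi, hc]
    rw [hs, hc', pow_succ]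
    ring

theorem prod_Icc_int_eq_prod_range (i k : ℕ) (F : ℤ → ℝ) :
    ∏ j ∈ Finset.Icc (-(i : ℤ)) ((k : ℤ) - (i : ℤ) - 1), F j =
      ∏ t ∈ Finset.range k, F ((t : ℤ) - i) := by
  refine Finset.prod_nbij' (fun j => (j + i).toNat) (fun t => (t : ℤ) - i) ?_ ?_ ?_ ?_ ?_ <;>
    intro j hj <;> simp only [Finset.mem_Icc, Finset.mem_range] at * <;> try omega
  congr 1
  omega

/-- The first three conjuncts say that `⟨1⟩_{a,b}` and `⟨p_k⟩_{a,b}` are genuine (convergent)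
integrals and that the quotient defining `I_k` has a nonzero denominator. For `i ≥ N` the product
contains the factor `j = -N`, which is `0`; such summands vanish. For `i < N` every denominator is
positive. -/
theorem mainTheorem4 (N : ℕ) (a b : ℝ) (ha : 0 < a) (hb : 0 < b) (k : ℕ) (hk : 0 < k) :
    IntegrableOn (jacobiWeight N a b) (Set.Icc (0 : Fin N → ℝ) 1) ∧
    IntegrableOn (fun x => powerSum N k x * jacobiWeight N a b x)
      (Set.Icc (0 : Fin N → ℝ) 1) ∧
    0 < jacobiBracket N a b (fun _ => 1) ∧
    jacobiMoment N a b k =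
      1 / (k.factorial : ℝ) *
        ∑ i ∈ Finset.range k, (-1 : ℝ) ^ i * ((k - 1).choose i : ℝ) *
          ∏ j ∈ Finset.Icc (-(i : ℤ)) ((k : ℤ) - (i : ℤ) - 1),
            ((N : ℝ) + (j : ℝ)) * (a + (N : ℝ) + (j : ℝ) - 1) /
              (a + b + 2 * (N : ℝ) + (j : ℝ) - 2) := by

  refine ⟨integrableOn_jacobiWeight ha hb N, integrableOn_powerSum_mul_jacobiWeight ha hb N k,
    jacobiBracket_one_pos ha hb N, ?_⟩
  have hpos := jacobiBracket_one_pos ha hb N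
  rw [jacobiMoment, div_eq_iff hpos.ne', jacobiBracket_powerSum ha hb, jacobiBracket_one ha hb]
  simp only [det_beta_update ha hb]
  rw [← Finset.sum_mul]
  congr 1
  rw [← Finset.sum_range fun r : ℕ =>
    (∏ t ∈ Finset.range k, (a + r + t) / (a + b + r + t + N - 1)) *
      (Lagrange.basis (Finset.range N) (fun n : ℕ => (n : ℝ)) r).eval ((r : ℝ) + k),
    ← Finset.sum_range_reflect, Finset.mul_sum]
  simp only [prod_Icc_int_eq_prod_range]
  set T : ℕ → ℝ := fun i => 1 / (k.factorial : ℝ) * ((-1 : ℝ) ^ i * ((k - 1).choose i : ℝ) *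
    ∏ t ∈ Finset.range k, ((N : ℝ) + (((t : ℤ) - (i : ℤ) : ℤ) : ℝ)) *
      (a + (N : ℝ) + (((t : ℤ) - (i : ℤ) : ℤ) : ℝ) - 1) /
        (a + b + 2 * (N : ℝ) + (((t : ℤ) - (i : ℤ) : ℤ) : ℝ) - 2)) with hT
  -- The determinants give a sum over `i < N`, the formula one over `i < k`; the terms in excess
  -- vanish on either side.
  have hTk : ∀ i, k ≤ i → T i = 0 := fun i hi => by
    simp only [hT]
    rw [Nat.choose_eq_zero_of_lt (by omega)]
    simp
  have hTN : ∀ i ∈ Finset.range k, N ≤ i → T i = 0 := fun i hik hi => by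
    rw [Finset.mem_range] at hik
    simp only [hT]
    -- The index `t = i - N` is `j = -N`; its factor has numerator `0`, hence is `0` even over a
    -- zero denominator.
    rw [Finset.prod_eq_zero (Finset.mem_range.2 (show i - N < k by omega))]
    · simp
    · push_cast [Nat.cast_sub hi]
      simp
  trans ∑ i ∈ Finset.range N, T i
  · refine Finset.sum_congr rfl fun i hi => ?_
    rw [Finset.mem_range] at hi
    obtain ⟨r, rfl⟩ : ∃ r, N = r + 1 + i := ⟨N - 1 - i, by omega⟩
    rw [show r + 1 + i - 1 - i = r by omega, lagrange_basis_eval_shift r i hk]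
    simp only [hT]
    rw [mul_left_comm, mul_left_comm (1 / (k.factorial : ℝ))]
    congr 1
    rw [mul_left_comm, ← Finset.prod_mul_distrib]
    congr 1
    refine Finset.prod_congr rfl fun t _ => ?_
    rw [div_mul_eq_mul_div]
    push_cast
    congr 1 <;> ring
  · rcases le_total N k with h | h
    · refine Finset.sum_subset (Finset.range_subset_range.2 h) fun i hi hi' => hTN i hi ?_
      simpa using hi'
    · refine (Finset.sum_subset (Finset.range_subset_range.2 h) fun i _ hi' => hTk i ?_).symm
      simpa using hi'
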